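/- Let $d\ge 5$. Let $(B_s)_{s\ge 0}$ be a standard Brownian motion in $\mathbb{R}^d$ started at the origin, with law $\mathrm{P}$, and for $r,t>0$ let $W^{0,r}_{[0,t]}=\bigcup_{0\le s\le t}\mathcal{B}(B_s,r)$ be its Wiener sausage, where $\mathcal{B}(z,r)$ is the open Euclidean ball. Let $\mathrm{cap}$ be the Newtonian capacity: for a Borel set $A\subseteq\mathbb{R}^d$, $$\mathrm{cap}(A)=\Big[\inf_{\nu}\int_A\int_A G(x,y)\,\nu(\mathrm{d}x)\,\nu(\mathrm{d}y)\Big]^{-1},\qquad G(x,y)=\frac{\Gamma(d/2-1)}{2\pi^{d/2}\,\|x-y\|^{d-2}},$$ the infimum being over all Borel probability measures $\nu$ on $A$. There is a constant $c>0$, depending only on $d$, such that for all $R>0$ and $\delta>0$ there exists $j_0\in(0,\infty)$, depending only on $d$, $R$ and $\delta$, such that for every radius $r\in(0,R]$, every time $t\ge\delta r^2$ and every real $j\ge j_0$, $$\mathrm{P}\big(\mathrm{cap}(W^{0,r}_{[0,t]})\ge j\,t\,r^{d-4}\big)\le e^{-cjt}.$$ In particular, for each fixed $r>0$ there is a $j_0$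 that serves all $t\ge r^2$, and for each fixed $r,t>0$ there is a $j_0$. -/

import Mathlib

open MeasureTheory ProbabilityTheory
open scoped ENNReal NNReal

noncomputable section

/-- The Green function of Brownian motion on `ℝ^d` for `d ≥ 3`,
`G(x, y) = Γ(d/2 - 1) / (2 π^(d/2) ‖x - y‖^(d-2))`, with value `∞` on the diagonal. -/
def greenFunction (d : ℕ) (x y : EuclideanSpace ℝ (Fin d)) : ℝ≥0∞ :=
  ENNReal.ofReal (Real.Gamma ((d : ℝ) / 2 - 1) / (2 * Real.pi ^ ((d : ℝ) / 2))) /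
    edist x y ^ (d - 2)

/-- The energy `∫_A ∫_A G(x, y) ν(dx) ν(dy)` of a measure on `A`. -/
def greenEnergy (d : ℕ) (A : Set (EuclideanSpace ℝ (Fin d)))
    (ν : Measure (EuclideanSpace ℝ (Fin d))) : ℝ≥0∞ :=
  ∫⁻ y in A, ∫⁻ x in A, greenFunction d x y ∂ν ∂ν

/-- The Newtonian capacity of `A`: the inverse of the infimum of the energies of the Borel
probability measures carried by `A` (with `∞⁻¹ = 0` and `0⁻¹ = ∞`). -/
def newtonianCapacity (d : ℕ) (A : Set (EuclideanSpace ℝ (Fin d))) : ℝ≥0∞ :=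
  (⨅ (ν : Measure (EuclideanSpace ℝ (Fin d))) (_ : IsProbabilityMeasure ν) (_ : ν Aᶜ = 0),
    greenEnergy d A ν)⁻¹

/-- Standard `d`-dimensional Brownian motion started at the origin: the coordinates are independent
one-dimensional standard Brownian motions (with almost surely continuous paths). -/
structure IsBrownianMotion {d : ℕ} {Ω : Type*} [MeasurableSpace Ω]
    (B : ℝ≥0 → Ω → EuclideanSpace ℝ (Fin d)) (P : Measure Ω) : Prop where
  isBrownianReal_coord : ∀ i : Fin d, IsBrownianReal (fun t ω => B t ω i) P
  iIndepFun_coord : iIndepFun (fun (i : Fin d) (ω : Ω) (t : ℝ≥0) => B t ω i) P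

/-- The Wiener sausage of radius `r` up to time `t` around a path `b`: the union of the open balls
of radius `r` centred at `b s`, `0 ≤ s ≤ t`. -/
def wienerSausage {d : ℕ} (b : ℝ≥0 → EuclideanSpace ℝ (Fin d)) (r : ℝ) (t : ℝ≥0) :
    Set (EuclideanSpace ℝ (Fin d)) :=
  ⋃ s ∈ Set.Icc (0 : ℝ≥0) t, Metric.ball (b s) r

end

/-! A probability measure on a union of n balls of radius ρ has energy at least a constant times 1 /
(n ρ^(d-2)), so the union has capacity at most of order n ρ^(d-2)
(`newtonianCapacity_le_of_subset_iUnion_ball`). It thus suffices to cover the path by about j t / r²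
balls of radius r, since r^(d-2) · j t / r² = j t r^(d-4).

The cover comes from dyadic chaining (`exists_finset_cover_path`). Time is cut into M blocks of
length a small multiple of r², refined dyadically; the centres are the block starts and the ends of
increments above a threshold that decays more slowly than their typical size 2^(-k/2). The number of
large increments is a sum of independent rare indicators, so Chernoff gives exponential tails whose
rate grows with the level (`measureReal_le_card_largeIncrements_blockLength`), and a union bound
over levels and coordinates finishes. Shorter blocks make the rate L as large as wanted, at the
price of a larger j₀. -/

/-! ### Capacity of a union of balls. -/

/-- The constant in the Green function. -/
noncomputable def greenConst (d : ℕ) : ℝ :=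
  Real.Gamma ((d : ℝ) / 2 - 1) / (2 * Real.pi ^ ((d : ℝ) / 2))

lemma greenConst_pos {d : ℕ} (hd : 3 ≤ d) : 0 < greenConst d := by
  have h : (3 : ℝ) ≤ d := by exact_mod_cast hd
  have := Real.Gamma_pos_of_pos (s := (d : ℝ) / 2 - 1) (by linarith)
  have := Real.pi_pos
  unfold greenConst
  positivity

lemma le_greenFunction (d : ℕ) {ρ : ℝ} (hρ : 0 < ρ) {x y : EuclideanSpace ℝ (Fin d)}
    (hxy : dist x y ≤ ρ) :
    ENNReal.ofReal (greenConst d / ρ ^ (d - 2)) ≤ greenFunction d x y := by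
  rw [ENNReal.ofReal_div_of_pos (by positivity), ENNReal.ofReal_pow hρ.le]
  unfold greenFunction greenConst
  gcongr
  rw [edist_dist]
  exact ENNReal.ofReal_le_ofReal hxy

/-- Cauchy–Schwarz; it bounds from below the energy of a unit mass split among n cells. -/
lemma ENNReal.inv_card_le_sum_sq {n : ℕ} {p : Fin n → ℝ≥0∞} (hp : ∑ i, p i = 1) :
    (n : ℝ≥0∞)⁻¹ ≤ ∑ i, p i ^ 2 := by
  have hfin : ∀ i, p i ≠ ∞ := fun i =>
    ne_top_of_le_ne_top (by simp) ((Finset.single_le_sum (by simp) (Finset.mem_univ i)).trans hp.le)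
  lift p to Fin n → ℝ≥0 using hfin
  have hp' : ∑ i, p i = 1 := by
    simp only at hp
    exact_mod_cast hp
  have h := sq_sum_le_card_mul_sum_sq (s := Finset.univ) (f := fun i => (p i : ℝ))
  have h1 : ∑ i, (p i : ℝ) = 1 := by exact_mod_cast hp'
  rw [h1, Finset.card_univ, Fintype.card_fin, one_pow] at h
  have h2 : (1 : ℝ≥0∞) ≤ n * ∑ i, (p i : ℝ≥0∞) ^ 2 := by exact_mod_cast h
  rw [ENNReal.inv_le_iff_le_mul (by simp) (by simp)]
  exact h2

/-- The capacity of a set covered by `n` balls is at most `n` times a constant. -/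
lemma newtonianCapacity_le_of_subset_iUnion_ball {d : ℕ} (hd : 3 ≤ d) {n : ℕ}
    {x : Fin n → EuclideanSpace ℝ (Fin d)} {ρ : ℝ} (hρ : 0 < ρ)
    {A : Set (EuclideanSpace ℝ (Fin d))} (hA : A ⊆ ⋃ i, Metric.ball (x i) ρ) :
    newtonianCapacity d A ≤ n * ENNReal.ofReal ((2 * ρ) ^ (d - 2) / greenConst d) := by
  have hκ := greenConst_pos hd
  unfold newtonianCapacity
  rw [ENNReal.inv_le_iff_inv_le]
  refine le_iInf fun ν => le_iInf fun hν => le_iInf fun hνA => ?_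
  -- Disjoint cells inside the balls: two points of one cell are within 2ρ, so the diagonal cells
  -- alone contribute g · ∑ ν(D i)² to the energy.
  set D := disjointed fun i => Metric.ball (x i) ρ
  have hDm : ∀ i, MeasurableSet (D i) := fun i =>
    disjointedRec (fun _ _ ht => ht.diff Metric.isOpen_ball.measurableSet)
      Metric.isOpen_ball.measurableSet
  have hDd : Pairwise (Function.onFun Disjoint D) := disjoint_disjointed _
  have hDu : ν (⋃ i, D i) = 1 := by
    rw [iUnion_disjointed]
    refine le_antisymm prob_le_one ?_
    have h1 : ν A = 1 := by
      refine le_antisymm prob_le_one ?_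
      have := measure_univ_le_add_compl (μ := ν) A
      simpa [hνA] using this
    exact h1 ▸ measure_mono hA
  have hsum : ∑ i, ν (D i) = 1 := by
    rw [← hDu, measure_iUnion hDd hDm, tsum_fintype]
  have hr : ν.restrict A = ν := Measure.restrict_eq_self_of_ae_mem (by rwa [ae_iff])
  set g := ENNReal.ofReal (greenConst d / (2 * ρ) ^ (d - 2))
  have hg : (ENNReal.ofReal ((2 * ρ) ^ (d - 2) / greenConst d))⁻¹ = g := by
    rw [← ENNReal.ofReal_inv_of_pos (by positivity), inv_div]
  have hcell : ∀ i, ∀ y ∈ D i, ν (D i) * g ≤ ∫⁻ z, greenFunction d z y ∂ν := by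
    intro i y hy
    calc ν (D i) * g = ∫⁻ _ in D i, g ∂ν := by rw [setLIntegral_const, mul_comm]
      _ ≤ ∫⁻ z in D i, greenFunction d z y ∂ν := by
        refine setLIntegral_mono' (hDm i) fun z hz => le_greenFunction d (by positivity) ?_
        have h1 := Metric.mem_ball.1 (disjointed_subset _ i hy)
        have h2 := Metric.mem_ball.1 (disjointed_subset _ i hz)
        linarith [dist_triangle_right z y (x i)]
      _ ≤ _ := setLIntegral_le_lintegral _ _
  unfold greenEnergy
  rw [hr]
  calc (n * ENNReal.ofReal ((2 * ρ) ^ (d - 2) / greenConst d))⁻¹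
      = (n : ℝ≥0∞)⁻¹ * g := by
        rw [ENNReal.mul_inv (Or.inr ENNReal.ofReal_ne_top) (Or.inl (by simp)), hg]
    _ ≤ (∑ i, ν (D i) ^ 2) * g := by gcongr; exact ENNReal.inv_card_le_sum_sq hsum
    _ = ∑ i, ∫⁻ _ in D i, ν (D i) * g ∂ν := by
        rw [Finset.sum_mul]
        refine Finset.sum_congr rfl fun i _ => ?_
        rw [setLIntegral_const]; ring
    _ ≤ ∑ i, ∫⁻ y in D i, ∫⁻ z, greenFunction d z y ∂ν ∂ν :=
        Finset.sum_le_sum fun i _ => setLIntegral_mono' (hDm i) (hcell i)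
    _ = ∫⁻ y in ⋃ i, D i, ∫⁻ z, greenFunction d z y ∂ν ∂ν := by
        rw [lintegral_iUnion hDm hDd, tsum_fintype]
    _ ≤ _ := setLIntegral_le_lintegral _ _

/-! ### Dyadic grids and chaining along a path. -/

/-- The `i`-th point of the grid of mesh `h / 2 ^ k`. -/
noncomputable def gridTime (h : ℝ≥0) (k i : ℕ) : ℝ≥0 := i * (h / 2 ^ k)

lemma gridTime_two_mul (h : ℝ≥0) (k i : ℕ) : gridTime h (k + 1) (2 * i) = gridTime h k i := by
  unfold gridTime
  push_cast
  field_simp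
  ring

lemma gridTime_monotone (h : ℝ≥0) (k : ℕ) : Monotone (gridTime h k) := by
  intro i j hij
  unfold gridTime
  gcongr

open Classical in
/-- The indices of the grid increments of level `k` whose size is at least `a`. -/
noncomputable def largeIncrements {E : Type*} [PseudoMetricSpace E] (b : ℝ≥0 → E) (h : ℝ≥0)
    (n k : ℕ) (a : ℝ) : Finset ℕ :=
  {i ∈ Finset.range n | a ≤ dist (b (gridTime h k (i + 1))) (b (gridTime h k i))}

/-- The index of the last grid point of level `k` before time `s`. -/
noncomputable def gridIndex (h s : ℝ≥0) (k : ℕ) : ℕ := ⌊s * 2 ^ k / h⌋₊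

lemma gridTime_gridIndex_le {h : ℝ≥0} (hh : 0 < h) (s : ℝ≥0) (k : ℕ) :
    gridTime h k (gridIndex h s k) ≤ s := by
  have h1 : (gridIndex h s k : ℝ≥0) ≤ s * 2 ^ k / h := Nat.floor_le (by positivity)
  calc gridTime h k (gridIndex h s k) ≤ s * 2 ^ k / h * (h / 2 ^ k) := by
        unfold gridTime; gcongr
    _ = s := by field_simp

lemma lt_gridTime_gridIndex {h : ℝ≥0} (hh : 0 < h) (s : ℝ≥0) (k : ℕ) :
    s < gridTime h k (gridIndex h s k) + h / 2 ^ k := by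
  have h1 : s * 2 ^ k / h < gridIndex h s k + 1 := Nat.lt_floor_add_one _
  calc s = s * 2 ^ k / h * (h / 2 ^ k) := by field_simp
    _ < (gridIndex h s k + 1) * (h / 2 ^ k) := by gcongr
    _ = _ := by unfold gridTime; ring

lemma gridIndex_lt {h : ℝ≥0} (hh : 0 < h) {s : ℝ≥0} {M : ℕ} (hs : s < M * h) (k : ℕ) :
    gridIndex h s k < M * 2 ^ k := by
  unfold gridIndex
  rw [Nat.floor_lt (by positivity), div_lt_iff₀ hh]
  push_cast
  calc s * 2 ^ k < M * h * 2 ^ k := by gcongr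
    _ = _ := by ring

lemma gridIndex_succ {h : ℝ≥0} (s : ℝ≥0) (k : ℕ) :
    gridIndex h s (k + 1) = 2 * gridIndex h s k ∨
      gridIndex h s (k + 1) = 2 * gridIndex h s k + 1 := by
  have h1 : gridIndex h s k = gridIndex h s (k + 1) / 2 := by
    unfold gridIndex
    rw [← Nat.floor_div_natCast]
    congr 1
    push_cast
    rw [pow_succ]
    field_simp
  lia

lemma tendsto_gridTime_gridIndex {h : ℝ≥0} (hh : 0 < h) (s : ℝ≥0) :
    Filter.Tendsto (fun k => gridTime h k (gridIndex h s k)) Filter.atTop (nhds s) := by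
  have h0 : Filter.Tendsto (fun k : ℕ => (h : ℝ) / 2 ^ k) Filter.atTop (nhds 0) := by
    have := (tendsto_pow_atTop_nhds_zero_of_lt_one (r := (1 / 2 : ℝ)) (by norm_num)
      (by norm_num)).const_mul (h : ℝ)
    simpa [div_eq_mul_inv] using this
  rw [← NNReal.tendsto_coe]
  refine tendsto_of_tendsto_of_tendsto_of_le_of_le (g := fun k : ℕ => (s : ℝ) - h / 2 ^ k)
    (h := fun _ => (s : ℝ)) (by simpa using h0.const_sub (s : ℝ)) tendsto_const_nhds ?_ ?_
  · intro k
    have : (s : ℝ) < gridTime h k (gridIndex h s k) + h / 2 ^ k := by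
      exact_mod_cast lt_gridTime_gridIndex hh s k
    simp only
    linarith
  · intro k
    exact_mod_cast gridTime_gridIndex_le hh s k

/-- A continuous path on `[0, M h)` is covered by the balls centred at the `M` block starting
points and at the right end points of the large increments of the dyadic grids. -/
lemma exists_finset_cover_path {E : Type*} [PseudoMetricSpace E] {b : ℝ≥0 → E} (hb : Continuous b)
    {h : ℝ≥0} (hh : 0 < h) (M : ℕ) {a : ℕ → ℝ} (ha : ∀ k, 0 < a k) {r : ℝ} (hr : HasSum a r)
    {K : ℕ} (hK : ∀ k, K ≤ k → largeIncrements b h (M * 2 ^ (k + 1)) (k + 1) (a k) = ∅) :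
    ∃ F : Finset E,
      F.card ≤ M + ∑ k ∈ Finset.range K,
        (largeIncrements b h (M * 2 ^ (k + 1)) (k + 1) (a k)).card ∧
      ∀ s < M * h, ∃ x ∈ F, dist (b s) x ≤ r := by
  classical
  refine ⟨(Finset.range M).image (fun i => b (gridTime h 0 i)) ∪
    (Finset.range K).biUnion fun k =>
      (largeIncrements b h (M * 2 ^ (k + 1)) (k + 1) (a k)).image
        fun i => b (gridTime h (k + 1) (i + 1)), ?_, ?_⟩
  · refine (Finset.card_union_le _ _).trans (add_le_add ?_ ?_)
    · simpa using Finset.card_image_le (s := Finset.range M) (f := fun i => b (gridTime h 0 i))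
    · exact Finset.card_biUnion_le.trans (Finset.sum_le_sum fun k _ => Finset.card_image_le)
  intro s hs
  set q : ℕ → E := fun k => b (gridTime h k (gridIndex h s k)) with hq
  have hlim : Filter.Tendsto q Filter.atTop (nhds (b s)) :=
    (hb.tendsto s).comp (tendsto_gridTime_gridIndex hh s)
  -- Either the last grid point before s is unchanged at the next level, or the move is a single
  -- fine increment starting at an even index, and q (k + 1) is its right end.
  have hlarge : ∀ k, a k ≤ dist (q k) (q (k + 1)) →
      k < K ∧ ∃ i ∈ largeIncrements b h (M * 2 ^ (k + 1)) (k + 1) (a k),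
        b (gridTime h (k + 1) (i + 1)) = q (k + 1) := by
    intro k hk
    have hmem : 2 * gridIndex h s k ∈ largeIncrements b h (M * 2 ^ (k + 1)) (k + 1) (a k) ∧
        b (gridTime h (k + 1) (2 * gridIndex h s k + 1)) = q (k + 1) := by
      rcases gridIndex_succ (h := h) s k with h1 | h1
      · have : q (k + 1) = q k := by simp only [hq, h1, gridTime_two_mul]
        rw [this, dist_self] at hk
        exact absurd hk (ha k).not_ge
      · have h2 := gridIndex_lt hh hs (k + 1)
        have h3 : b (gridTime h (k + 1) (2 * gridIndex h s k + 1)) = q (k + 1) := by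
          simp only [hq, h1]
        refine ⟨?_, h3⟩
        simp only [largeIncrements, Finset.mem_filter, Finset.mem_range]
        refine ⟨by lia, ?_⟩
        rw [h3, gridTime_two_mul, dist_comm]
        exact hk
    refine ⟨?_, _, hmem⟩
    by_contra hcon
    rw [hK k (not_lt.1 hcon)] at hmem
    simp at hmem
  have hchain : ∀ n, (∀ k, n ≤ k → dist (q k) (q (k + 1)) < a k) → dist (b s) (q n) ≤ r := by
    intro n hn
    have h1 := dist_le_tsum_of_dist_le_of_tendsto₀ (f := fun k => q (n + k))
      (fun k => a (n + k)) (fun k => (hn (n + k) (by lia)).le)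
      ((summable_nat_add_iff n).2 hr.summable |>.congr fun k => by rw [add_comm])
      (hlim.comp (Filter.tendsto_atTop_mono (fun k => Nat.le_add_left k n) Filter.tendsto_id))
    rw [dist_comm, ← hr.tsum_eq]
    refine h1.trans ?_
    rw [← hr.summable.sum_add_tsum_nat_add n]
    simp_rw [add_comm n]
    exact le_add_of_nonneg_left (Finset.sum_nonneg fun k _ => (ha k).le)
  -- The centre for s is the end of the last large jump of the chain, after which the small jumps
  -- add up to at most r; without large jumps it is the block start.
  by_cases hex : ∃ k ≤ K, a k ≤ dist (q k) (q (k + 1))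
  · obtain ⟨k₀, hk₀, hk₀'⟩ := hex
    set k := Nat.findGreatest (fun k => a k ≤ dist (q k) (q (k + 1))) K
    have hk : a k ≤ dist (q k) (q (k + 1)) :=
      Nat.findGreatest_spec (P := fun k => a k ≤ dist (q k) (q (k + 1))) hk₀ hk₀'
    obtain ⟨hkK, i, hi, hiq⟩ := hlarge k hk
    refine ⟨q (k + 1), ?_, hchain (k + 1) fun l hl => ?_⟩
    · refine Finset.mem_union_right _ (Finset.mem_biUnion.2 ⟨k, Finset.mem_range.2 hkK, ?_⟩)
      exact Finset.mem_image.2 ⟨i, hi, hiq⟩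
    · by_contra hcon
      have h1 := not_lt.1 hcon
      exact Nat.findGreatest_is_greatest (P := fun k => a k ≤ dist (q k) (q (k + 1)))
        (Nat.lt_of_succ_le hl) (hlarge l h1).1.le h1
  · refine ⟨q 0, ?_, hchain 0 fun l _ => ?_⟩
    · refine Finset.mem_union_left _ (Finset.mem_image.2 ⟨gridIndex h s 0, ?_, rfl⟩)
      simpa using gridIndex_lt hh hs 0
    · by_contra hcon
      have h1 := not_lt.1 hcon
      exact hex ⟨l, (hlarge l h1).1.le, h1⟩

/-! ### Exponential tails for the number of large increments. -/

open Classical in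
/-- Chernoff bound for the number of independent variables exceeding a level in absolute value. -/
lemma measureReal_le_card_le_exp {Ω : Type*} [MeasurableSpace Ω] {P : Measure Ω} {X : ℕ → Ω → ℝ}
    (hX : iIndepFun X P) (hm : ∀ i, AEMeasurable (X i) P) (n : ℕ) {a p l : ℝ} (hl : 0 ≤ l)
    (hp : ∀ i, P.real {ω | a ≤ |X i ω|} ≤ p) (x : ℝ) :
    P.real {ω | x ≤ (({i ∈ Finset.range n | a ≤ |X i ω|} : Finset ℕ).card : ℝ)} ≤
      Real.exp (-l * x + n * (p * Real.exp l)) := by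
  have := hX.isProbabilityMeasure
  set S : Set ℝ := {y | a ≤ |y|}
  have hS : MeasurableSet S := measurableSet_le measurable_const measurable_norm
  set f : ℝ → ℝ := S.indicator 1
  have hf : Measurable f := measurable_one.indicator hS
  set Y : ℕ → Ω → ℝ := fun i => f ∘ X i
  have hY : iIndepFun Y P := hX.comp (fun _ => f) fun _ => hf
  have hYm : ∀ i, AEMeasurable (Y i) P := fun i => hf.comp_aemeasurable (hm i)
  have hcard : ∀ ω, (({i ∈ Finset.range n | a ≤ |X i ω|} : Finset ℕ).card : ℝ) =
      (∑ i ∈ Finset.range n, Y i) ω := by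
    intro ω
    rw [Finset.sum_apply, Finset.card_filter]
    push_cast
    refine Finset.sum_congr rfl fun i _ => ?_
    simp [Y, f, S, Set.indicator_apply]
  -- Valid because Y takes only the values 0 and 1; it yields E exp(lY) ≤ 1 + p e^l ≤ exp(p e^l).
  have hbd : ∀ i ω, Real.exp (l * Y i ω) ≤ 1 + Real.exp l * (Y i ω) := by
    intro i ω
    by_cases h : X i ω ∈ S
    · simp [Y, f, h]
    · simp [Y, f, h]
  have hY01 : ∀ i ω, ‖Y i ω‖ ≤ 1 := by
    intro i ω
    by_cases h : X i ω ∈ S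
    · simp [Y, f, h]
    · simp [Y, f, h]
  have hYint : ∀ i, Integrable (Y i) P := fun i =>
    Integrable.of_bound (hYm i).aestronglyMeasurable 1 (Filter.Eventually.of_forall (hY01 i))
  have hmgf : ∀ i, mgf (Y i) P l ≤ Real.exp (p * Real.exp l) := by
    intro i
    have hint : ∫ ω, Y i ω ∂P ≤ p := by
      have h1 : Y i = (X i ⁻¹' S).indicator 1 := by
        ext ω; simp [Y, f, Set.indicator_apply]
      rw [h1, integral_indicator₀ ((hm i).nullMeasurableSet_preimage hS)]
      simpa using (show P.real (X i ⁻¹' S) ≤ p from hp i)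
    calc mgf (Y i) P l ≤ ∫ ω, (1 + Real.exp l * Y i ω) ∂P := by
          refine integral_mono_of_nonneg (Filter.Eventually.of_forall fun _ => (Real.exp_pos _).le)
            ((integrable_const _).add ((hYint i).const_mul _))
            (Filter.Eventually.of_forall (hbd i))
      _ = 1 + Real.exp l * ∫ ω, Y i ω ∂P := by
          rw [integral_add (integrable_const _) ((hYint i).const_mul _), integral_const_mul]
          simp
      _ ≤ p * Real.exp l + 1 := by nlinarith [Real.exp_pos l]
      _ ≤ _ := Real.add_one_le_exp _
  simp_rw [hcard]
  have hsum : AEMeasurable (∑ i ∈ Finset.range n, Y i) P :=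
    Finset.aemeasurable_sum _ fun i _ => hYm i
  have hexp : Integrable (fun ω => Real.exp (l * (∑ i ∈ Finset.range n, Y i) ω)) P := by
    refine Integrable.of_bound (by fun_prop) (Real.exp (l * n))
      (Filter.Eventually.of_forall fun ω => ?_)
    rw [Real.norm_of_nonneg (Real.exp_pos _).le]
    gcongr
    rw [← hcard ω]
    exact_mod_cast (Finset.card_filter_le _ _).trans (by simp)
  refine (measure_ge_le_exp_mul_mgf x hl hexp).trans ?_
  rw [hY.mgf_sum₀ hYm, Real.exp_add]
  gcongr
  calc ∏ i ∈ Finset.range n, mgf (Y i) P l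
      ≤ ∏ i ∈ Finset.range n, Real.exp (p * Real.exp l) :=
        Finset.prod_le_prod (fun _ _ => mgf_nonneg) fun i _ => hmgf i
    _ = _ := by rw [Finset.prod_const, Finset.card_range, ← Real.exp_nat_mul]

/-- Two-sided Gaussian tail bound. -/
lemma measureReal_le_abs_le_exp_of_hasLaw {Ω : Type*} [MeasurableSpace Ω] {P : Measure Ω}
    {X : Ω → ℝ} {v : ℝ≥0} (hX : HasLaw X (gaussianReal 0 v) P) {a : ℝ} (ha : 0 ≤ a) :
    P.real {ω | a ≤ |X ω|} ≤ 2 * Real.exp (-a ^ 2 / (2 * v)) := by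
  have := hX.isProbabilityMeasure
  have hsub : HasSubgaussianMGF X v P := by
    refine ⟨fun t => ?_, fun t => ?_⟩
    · have h1 := integrable_exp_mul_gaussianReal (μ := 0) (v := v) t
      rw [← hX.map_eq] at h1
      exact h1.comp_aemeasurable hX.aemeasurable
    · rw [mgf_gaussianReal hX.map_eq]
      simp
  have hset : {ω | a ≤ |X ω|} = {ω | a ≤ X ω} ∪ {ω | a ≤ (-X) ω} := by
    ext ω
    simp [le_abs]
  rw [hset, two_mul]
  exact (measureReal_union_le _ _).trans
    (add_le_add (hsub.measure_ge_le ha) (hsub.neg.measure_ge_le ha))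

lemma measureReal_le_card_largeIncrements {Ω : Type*} [MeasurableSpace Ω] {P : Measure Ω}
    {B : ℝ≥0 → Ω → ℝ} (hB : IsPreBrownianReal B P) (h : ℝ≥0) (n k : ℕ) {a l : ℝ}
    (ha : 0 ≤ a) (hl : 0 ≤ l) (x : ℝ) :
    P.real {ω | x ≤ ((largeIncrements (fun s => B s ω) h n k a).card : ℝ)} ≤
      Real.exp (-l * x + n * (2 * Real.exp (-a ^ 2 / (2 * (h / 2 ^ k))) * Real.exp l)) := by
  have hind := hB.hasIndepIncrements.nat (gridTime_monotone h k)
  have hnn : ∀ i, nndist (gridTime h k (i + 1)).1 (gridTime h k i).1 = h / 2 ^ k := by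
    intro i
    ext
    simp only [coe_nndist, Real.dist_eq, gridTime, NNReal.val_eq_coe]
    push_cast
    rw [abs_of_nonneg] <;> ring_nf
    positivity
  have hlaw : ∀ i, HasLaw (fun ω => B (gridTime h k (i + 1)) ω - B (gridTime h k i) ω)
      (gaussianReal 0 (h / 2 ^ k)) P := fun i => hnn i ▸ hB.hasLaw_sub _ _
  have := measureReal_le_card_le_exp hind (fun i => (hlaw i).aemeasurable) n hl
    (fun i => measureReal_le_abs_le_exp_of_hasLaw (hlaw i) ha) x
  push_cast at this
  unfold largeIncrements
  simp_rw [Real.dist_eq]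
  exact this

/-! ### Thresholds, budgets and the resulting capacity bound. -/

/-- The size above which an increment of grid level `k` counts as large. -/
noncomputable def incrementThreshold (r : ℝ) (k : ℕ) : ℝ := r / 5 * (5 / 6) ^ k

/-- Chaining costs at most r in all. The ratio 5/6 exceeds 1/√2, so threshold² over variance grows
like (2 · 25/36)^k = (25/18)^k. -/
lemma hasSum_incrementThreshold (r : ℝ) :
    HasSum (fun k => incrementThreshold r (k + 1)) r := by
  have h := (hasSum_geometric_of_lt_one (r := (5 / 6 : ℝ)) (by norm_num) (by norm_num)).mul_left
    (r / 5 * (5 / 6))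
  have h1 : r / 5 * (5 / 6) * (1 - 5 / 6)⁻¹ = r := by norm_num; ring
  have h2 : (fun k => incrementThreshold r (k + 1)) =
      fun k => r / 5 * (5 / 6) * (5 / 6 : ℝ) ^ k := by
    funext k
    simp only [incrementThreshold, pow_succ]
    ring
  rwa [h1, ← h2] at h

/-- Shares of the budget m allotted to the levels k ≥ 1. The ratio 4/5 exceeds 18/25, so share times
Chernoff rate still grows, like (10/9)^k. -/
lemma hasSum_four_fifths : HasSum (fun k : ℕ => 1 / 4 * (4 / 5 : ℝ) ^ (k + 1)) 1 := by
  have h := (hasSum_geometric_of_lt_one (r := (4 / 5 : ℝ)) (by norm_num) (by norm_num)).mul_left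
    (1 / 4 * (4 / 5) : ℝ)
  have h1 : 1 / 4 * (4 / 5) * (1 - 4 / 5 : ℝ)⁻¹ = 1 := by norm_num
  have h2 : (fun k : ℕ => 1 / 4 * (4 / 5 : ℝ) ^ (k + 1)) =
      fun k => 1 / 4 * (4 / 5) * (4 / 5 : ℝ) ^ k := by
    funext k
    simp only [pow_succ]
    ring
  rwa [h1, ← h2] at h

/-- A vector of norm at least a has a coordinate of size at least a / √d, which reduces the counts
to one dimension. -/
lemma card_largeIncrements_le_sum {d : ℕ} (b : ℝ≥0 → EuclideanSpace ℝ (Fin d))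
    (h : ℝ≥0) (n k : ℕ) {a : ℝ} (ha : 0 < a) :
    (largeIncrements b h n k a).card ≤
      ∑ i : Fin d, (largeIncrements (fun s => b s i) h n k (a / √d)).card := by
  classical
  refine le_trans (Finset.card_le_card ?_) Finset.card_biUnion_le
  intro l hl
  simp only [largeIncrements, Finset.mem_filter, Finset.mem_biUnion, Finset.mem_univ,
    true_and] at hl ⊢
  by_contra! hcon
  have h1 : ∀ i, dist (b (gridTime h k (l + 1)) i) (b (gridTime h k l) i) < a / √d :=
    fun i => hcon i hl.1
  have hlt : dist (b (gridTime h k (l + 1))) (b (gridTime h k l)) < a := by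
    rw [EuclideanSpace.dist_eq, Real.sqrt_lt' ha]
    rcases Nat.eq_zero_or_pos d with rfl | hd
    · simpa using pow_pos ha 2
    · have hd' : (0 : ℝ) < d := by exact_mod_cast hd
      have : Nonempty (Fin d) := ⟨⟨0, hd⟩⟩
      calc ∑ i, dist (b (gridTime h k (l + 1)) i) (b (gridTime h k l) i) ^ 2
          < ∑ _i : Fin d, (a / √d) ^ 2 := by
            refine Finset.sum_lt_sum_of_nonempty Finset.univ_nonempty fun i _ => ?_
            exact pow_lt_pow_left₀ (h1 i) dist_nonneg two_ne_zero
        _ = a ^ 2 := by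
            rw [Finset.sum_const, Finset.card_univ, Fintype.card_fin, nsmul_eq_mul, div_pow,
              Real.sq_sqrt hd'.le]
            field_simp
  exact hlt.not_ge hl.2

/-- If the path has few large grid increments, the capacity of its sausage is small. -/
lemma newtonianCapacity_wienerSausage_le {d : ℕ} (hd : 3 ≤ d)
    {b : ℝ≥0 → EuclideanSpace ℝ (Fin d)} (hb : Continuous b) {h : ℝ≥0} (hh : 0 < h) {r : ℝ}
    (hr : 0 < r) {t : ℝ≥0} {M : ℕ} (ht : t < M * h) {m : ℝ} (hm : 0 ≤ m)
    (hlarge : ∀ k (i : Fin d), ((largeIncrements (fun s => b s i) h (M * 2 ^ (k + 1)) (k + 1)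
      (incrementThreshold r (k + 1) / √d)).card : ℝ) < 1 / 4 * (4 / 5) ^ (k + 1) * m) :
    newtonianCapacity d (wienerSausage b r t) ≤
      ENNReal.ofReal ((M + d * m) * ((4 * r) ^ (d - 2) / greenConst d)) := by
  have hpos : ∀ k, 0 < incrementThreshold r (k + 1) := fun k => by
    unfold incrementThreshold; positivity
  have hcard : ∀ k, ((largeIncrements b h (M * 2 ^ (k + 1)) (k + 1)
      (incrementThreshold r (k + 1))).card : ℝ) ≤ d * m * (1 / 4 * (4 / 5) ^ (k + 1)) := by
    intro k
    calc _ ≤ ∑ i : Fin d, ((largeIncrements (fun s => b s i) h (M * 2 ^ (k + 1)) (k + 1)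
          (incrementThreshold r (k + 1) / √d)).card : ℝ) := by
          exact_mod_cast card_largeIncrements_le_sum b h _ _ (hpos k)
      _ ≤ ∑ _i : Fin d, 1 / 4 * (4 / 5) ^ (k + 1) * m :=
          Finset.sum_le_sum fun i _ => (hlarge k i).le
      _ = _ := by
          rw [Finset.sum_const, Finset.card_univ, Fintype.card_fin, nsmul_eq_mul]; ring
  have hsum := hasSum_four_fifths.mul_left (d * m)
  -- Once the budget of a level is below 1, the integer count there is 0, so finitely many levels
  -- matter.
  obtain ⟨K, hK⟩ := Filter.eventually_atTop.1
    (hsum.summable.tendsto_atTop_zero.eventually (gt_mem_nhds one_pos))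
  obtain ⟨F, hFc, hF⟩ := exists_finset_cover_path hb hh M hpos (hasSum_incrementThreshold r)
    (K := K) (fun k hk => by
      have h1 := (hcard k).trans_lt (hK k hk)
      rw [← Finset.card_eq_zero]
      have : (largeIncrements b h (M * 2 ^ (k + 1)) (k + 1)
        (incrementThreshold r (k + 1))).card < 1 := by exact_mod_cast h1
      lia)
  have hF' : (F.card : ℝ) ≤ M + d * m := by
    calc (F.card : ℝ) ≤ M + ∑ k ∈ Finset.range K, ((largeIncrements b h (M * 2 ^ (k + 1)) (k + 1)
          (incrementThreshold r (k + 1))).card : ℝ) := by exact_mod_cast hFc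
      _ ≤ M + ∑ k ∈ Finset.range K, d * m * (1 / 4 * (4 / 5) ^ (k + 1)) := by
          gcongr with k _; exact hcard k
      _ ≤ M + d * m := by
          gcongr
          simpa using sum_le_hasSum (Finset.range K) (fun k _ => by positivity) hsum
  have hsub : wienerSausage b r t ⊆
      ⋃ i, Metric.ball ((F.equivFin.symm i : EuclideanSpace ℝ (Fin d))) (2 * r) := by
    intro z hz
    simp only [wienerSausage, Set.mem_iUnion, Set.mem_Icc] at hz
    obtain ⟨s, hs, hz⟩ := hz
    obtain ⟨x, hx, hsx⟩ := hF s (hs.2.trans_lt ht)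
    refine Set.mem_iUnion.2 ⟨F.equivFin ⟨x, hx⟩, ?_⟩
    rw [Equiv.symm_apply_apply, Metric.mem_ball]
    rw [Metric.mem_ball] at hz
    linarith [dist_triangle z (b s) x]
  refine (newtonianCapacity_le_of_subset_iUnion_ball hd (by positivity) hsub).trans ?_
  have hκ := greenConst_pos hd
  rw [← ENNReal.ofReal_natCast, ← ENNReal.ofReal_mul (by positivity), ← mul_assoc 2 2 r]
  norm_num only
  refine ENNReal.ofReal_le_ofReal ?_
  gcongr

/-! ### Calibrated tails and the union bound. -/

/-- Pays for the 2^k increments per block at level k: this is the purpose of the spare 3 in the L +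
3 of `blockLength`. By Bernoulli, 3 (25/18)^k ≥ k + 1. -/
lemma two_pow_mul_exp_le_one (k : ℕ) :
    (2 : ℝ) ^ k * (2 * Real.exp (-(3 * (25 / 18 : ℝ) ^ k))) ≤ 1 := by
  have h1 : 1 + (k : ℝ) * (7 / 18) ≤ (25 / 18 : ℝ) ^ k := by
    have := one_add_mul_le_pow (a := (7 / 18 : ℝ)) (by norm_num) k
    norm_num at this ⊢
    exact this
  have h2 : (2 : ℝ) ^ (k + 1) ≤ Real.exp (k + 1) := by
    have h3 : (2 : ℝ) ≤ Real.exp 1 := by linarith [Real.add_one_le_exp 1]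
    calc (2 : ℝ) ^ (k + 1) ≤ Real.exp 1 ^ (k + 1) := by gcongr
      _ = _ := by rw [← Real.exp_nat_mul]; push_cast; ring_nf
  calc (2 : ℝ) ^ k * (2 * Real.exp (-(3 * (25 / 18 : ℝ) ^ k)))
      = 2 ^ (k + 1) * Real.exp (-(3 * (25 / 18 : ℝ) ^ k)) := by ring
    _ ≤ Real.exp (k + 1) * Real.exp (-(k + 1)) := by
        gcongr
        linarith [(Nat.cast_nonneg k : (0 : ℝ) ≤ k)]
    _ = 1 := by rw [← Real.exp_add]; simp

/-- The block length for which the counts of large increments have exponential tails with rate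
`L`. -/
noncomputable def blockLength (d : ℕ) (L r : ℝ) : ℝ≥0 := (r ^ 2 / (50 * d * (L + 3))).toNNReal

/-- The block length makes the Gaussian exponent exactly (L + 3)(25/18)^k; Chernoff with parameter L
(25/18)^k then leaves an expected-count term of at most M. -/
lemma measureReal_le_card_largeIncrements_blockLength {Ω : Type*} [MeasurableSpace Ω]
    {P : Measure Ω} {B : ℝ≥0 → Ω → ℝ} (hB : IsPreBrownianReal B P) {d : ℕ} (hd : 0 < d)
    {L : ℝ} (hL : 0 ≤ L) {r : ℝ} (hr : 0 < r) (M k : ℕ) (x : ℝ) :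
    P.real {ω | x ≤ ((largeIncrements (fun s => B s ω) (blockLength d L r) (M * 2 ^ k) k
      (incrementThreshold r k / √d)).card : ℝ)} ≤ Real.exp (-(L * (25 / 18) ^ k) * x + M) := by
  have hd' : (0 : ℝ) < d := by exact_mod_cast hd
  refine (measureReal_le_card_largeIncrements hB _ _ k (l := L * (25 / 18) ^ k)
    (by unfold incrementThreshold; positivity) (by positivity) x).trans ?_
  gcongr
  have hexp : -(incrementThreshold r k / √d) ^ 2 / (2 * ((blockLength d L r : ℝ) / 2 ^ k)) =
      -((L + 3) * (25 / 18) ^ k) := by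
    unfold blockLength incrementThreshold
    rw [Real.coe_toNNReal _ (by positivity), div_pow, Real.sq_sqrt hd'.le,
      show (25 / 18 : ℝ) = 5 / 6 * (5 / 6) * 2 by norm_num, mul_pow, mul_pow]
    field_simp
    rw [← pow_mul, mul_comm k 2, pow_mul]
    norm_num [mul_comm]
  rw [hexp, mul_assoc 2, ← Real.exp_add]
  have h1 := two_pow_mul_exp_le_one k
  push_cast
  calc (M : ℝ) * 2 ^ k * (2 * Real.exp (-((L + 3) * (25 / 18) ^ k) + L * (25 / 18) ^ k))
      = M * (2 ^ k * (2 * Real.exp (-(3 * (25 / 18 : ℝ) ^ k)))) := by ring_nf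
    _ ≤ M * 1 := by gcongr
    _ = M := mul_one _

lemma IsBrownianMotion.ae_continuous {d : ℕ} {Ω : Type*} [MeasurableSpace Ω] {P : Measure Ω}
    {B : ℝ≥0 → Ω → EuclideanSpace ℝ (Fin d)} (hB : IsBrownianMotion B P) :
    ∀ᵐ ω ∂P, Continuous fun s => B s ω := by
  filter_upwards [ae_all_iff.2 fun i => (hB.isBrownianReal_coord i).cont] with ω hω
  exact (PiLp.continuous_toLp 2 _).comp (continuous_pi hω)

/-- Upper tail of the capacity of the Wiener sausage in terms of the block count `M` and a free
parameter `m`. -/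
lemma measure_le_newtonianCapacity_wienerSausage {d : ℕ} (hd : 3 ≤ d) {Ω : Type*}
    [MeasurableSpace Ω] {P : Measure Ω} [IsProbabilityMeasure P]
    {B : ℝ≥0 → Ω → EuclideanSpace ℝ (Fin d)} (hB : IsBrownianMotion B P) {L : ℝ} (hL : 36 ≤ L)
    {r : ℝ} (hr : 0 < r) {t : ℝ≥0} {M : ℕ} (ht : t < M * blockLength d L r) {m : ℝ} (hm : 1 ≤ m)
    (hMm : (M : ℝ) ≤ 2 * d * m) {u : ℝ}
    (hu : (M + d * m) * ((4 * r) ^ (d - 2) / greenConst d) < u) :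
    P {ω | ENNReal.ofReal u ≤ newtonianCapacity d (wienerSausage (fun s => B s ω) r t)} ≤
      ENNReal.ofReal (Real.exp (-((L / 4 - 3 * d) * m))) := by
  have hd' : 0 < d := by lia
  have hκ := greenConst_pos hd
  set h := blockLength d L r
  have hh : 0 < h := by
    have : (0 : ℝ) < d := by exact_mod_cast hd'
    exact Real.toNNReal_pos.2 (by positivity)
  set E : ℕ → Fin d → Set Ω := fun k i => {ω | 1 / 4 * (4 / 5) ^ (k + 1) * m ≤
    ((largeIncrements (fun s => B s ω i) h (M * 2 ^ (k + 1)) (k + 1)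
      (incrementThreshold r (k + 1) / √d)).card : ℝ)}
  have hE : ∀ k i, P (E k i) ≤
      ENNReal.ofReal (Real.exp (-((L / 4 - 2 * d) * m))) * 2⁻¹ ^ (k + 1) := by
    intro k i
    have h1 := measureReal_le_card_largeIncrements_blockLength
      (hB.isBrownianReal_coord i).toIsPreBrownianReal hd' (by linarith : 0 ≤ L) hr M (k + 1)
      (1 / 4 * (4 / 5) ^ (k + 1) * m)
    rw [← ofReal_measureReal, ← ENNReal.ofReal_ofNat 2, ← ENNReal.ofReal_inv_of_pos two_pos,
      ← ENNReal.ofReal_pow (by positivity), ← ENNReal.ofReal_mul (by positivity)]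
    refine ENNReal.ofReal_le_ofReal (h1.trans ?_)
    have h2 : (1 : ℝ) + (k + 1 : ℕ) * (1 / 9) ≤ (10 / 9) ^ (k + 1) := by
      have := one_add_mul_le_pow (a := (1 / 9 : ℝ)) (by norm_num) (k + 1)
      norm_num at this ⊢
      exact this
    have h3 : Real.exp (-(k + 1 : ℕ)) ≤ (2 : ℝ)⁻¹ ^ (k + 1) := by
      have : (2 : ℝ) ≤ Real.exp 1 := by linarith [Real.add_one_le_exp 1]
      rw [← mul_one ((k + 1 : ℕ) : ℝ), ← mul_neg, Real.exp_nat_mul, Real.exp_neg]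
      gcongr
    refine le_trans ?_ (mul_le_mul_of_nonneg_left h3 (Real.exp_pos _).le)
    rw [← Real.exp_add]
    refine Real.exp_le_exp.2 ?_
    have h4 : -(L * (25 / 18) ^ (k + 1)) * (1 / 4 * (4 / 5) ^ (k + 1) * m) =
        -(L / 4 * m * (10 / 9) ^ (k + 1)) := by
      rw [show (10 / 9 : ℝ) = 25 / 18 * (4 / 5) by norm_num, mul_pow]; ring
    rw [h4]
    have h5 : L / 4 * m * (1 + (k + 1 : ℕ) * (1 / 9)) ≤ L / 4 * m * (10 / 9) ^ (k + 1) := by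
      gcongr
    -- L ≥ 36 and m ≥ 1 turn the linear part of (10/9)^(k+1) into the summable factor 2^(-(k+1)).
    have h6 : (1 : ℝ) * ((k + 1 : ℕ) : ℝ) ≤ L / 36 * m * (k + 1 : ℕ) := by
      gcongr
      nlinarith
    linarith
  have hsub : {ω | ENNReal.ofReal u ≤ newtonianCapacity d (wienerSausage (fun s => B s ω) r t)}
      ⊆ {ω | ¬ Continuous fun s => B s ω} ∪ ⋃ k, ⋃ i, E k i := by
    intro ω hω
    by_contra hcon
    simp only [Set.mem_union, Set.mem_ofPred_eq, not_or, not_not, Set.mem_iUnion, not_exists,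
      E, not_le] at hcon hω
    have h1 := hω.trans (newtonianCapacity_wienerSausage_le hd hcon.1 hh hr ht
      (by linarith) hcon.2)
    rw [ENNReal.ofReal_le_ofReal_iff (by positivity)] at h1
    linarith
  refine (measure_mono hsub).trans ((measure_union_le _ _).trans ?_)
  rw [ae_iff.1 hB.ae_continuous, zero_add]
  calc P (⋃ k, ⋃ i, E k i) ≤ ∑' k, ∑ i, P (E k i) :=
        (measure_iUnion_le _).trans (ENNReal.tsum_le_tsum fun k =>
          (measure_iUnion_le _).trans (tsum_fintype _).le)
    _ ≤ ∑' k, ∑ _i : Fin d,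
          ENNReal.ofReal (Real.exp (-((L / 4 - 2 * d) * m))) * 2⁻¹ ^ (k + 1) := by
        gcongr with k i; exact hE k i
    _ = d * ENNReal.ofReal (Real.exp (-((L / 4 - 2 * d) * m))) := by
        simp_rw [Finset.sum_const, Finset.card_univ, Fintype.card_fin, nsmul_eq_mul, ← mul_assoc]
        rw [ENNReal.tsum_mul_left, ENNReal.tsum_geometric_add_one, ENNReal.one_sub_inv_two, inv_inv,
          ENNReal.inv_mul_cancel two_ne_zero ENNReal.ofNat_ne_top, mul_one]
    _ = ENNReal.ofReal (d * Real.exp (-((L / 4 - 2 * d) * m))) := by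
        rw [ENNReal.ofReal_mul (by positivity), ENNReal.ofReal_natCast]
    _ ≤ _ := by
        refine ENNReal.ofReal_le_ofReal ?_
        -- The factor d from the union over coordinates costs one more d * m: hence 3d in place of
        -- 2d.
        have h1 : (d : ℝ) ≤ Real.exp (d * m) := by
          have := Real.add_one_le_exp (d * m)
          nlinarith [(Nat.cast_nonneg d : (0 : ℝ) ≤ d)]
        calc (d : ℝ) * Real.exp (-((L / 4 - 2 * d) * m))
            ≤ Real.exp (d * m) * Real.exp (-((L / 4 - 2 * d) * m)) := by gcongr
          _ = _ := by rw [← Real.exp_add]; ring_nf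

/-! ### Choice of the parameters. -/

theorem mainTheorem4 (d : ℕ) (hd : 5 ≤ d) :
    ∃ c : ℝ, 0 < c ∧
      ∀ R : ℝ, 0 < R → ∀ δ : ℝ, 0 < δ →
        ∃ j₀ : ℝ, 0 < j₀ ∧
          ∀ {Ω : Type*} [MeasurableSpace Ω] (P : Measure Ω) [IsProbabilityMeasure P]
            (B : ℝ≥0 → Ω → EuclideanSpace ℝ (Fin d)), IsBrownianMotion B P →
            ∀ r : ℝ, 0 < r → r ≤ R →
              ∀ t : ℝ≥0, δ * r ^ 2 ≤ (t : ℝ) →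
                ∀ j : ℝ, j₀ ≤ j →
                  P {ω | ENNReal.ofReal (j * (t : ℝ) * r ^ (d - 4)) ≤
                      newtonianCapacity d (wienerSausage (fun s => B s ω) r t)} ≤
                    ENNReal.ofReal (Real.exp (-(c * j * (t : ℝ)))) := by
  refine ⟨1, one_pos, fun R hR δ hδ => ?_⟩
  have hκ := greenConst_pos (d := d) (by lia)
  have hd1 : (1 : ℝ) ≤ d := by exact_mod_cast (by lia : 1 ≤ d)
  have hd0 : (0 : ℝ) < d := by linarith
  set K : ℝ := 4 ^ (d - 2) / greenConst d with hKdef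
  have hK : 0 < K := by positivity
  -- Chosen so that (L / 4 - 3d) m ≥ 4 K d r² m = j t for every r ≤ R, which gives c = 1.
  set L : ℝ := 4 * (3 * d + 4 * K * d * R ^ 2) + 36 with hLdef
  have hL : 36 ≤ L := by
    have : 0 ≤ 4 * (3 * d + 4 * K * d * R ^ 2) := by positivity
    linarith
  set η : ℝ := 1 / (50 * d * (L + 3)) with hη
  have hη0 : 0 < η := by positivity
  -- With t ≥ δ r², the first term forces m ≥ 1; the second forces t / (η r²) ≤ d m, whence M ≤ 2 d
  -- m.
  refine ⟨4 * K * d / δ + 4 * K / η, by positivity, ?_⟩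
  intro Ω _ P _ B hB r hr hrR t ht j hj
  have hj1 : 4 * K * d / δ ≤ j := le_trans (by simp only [le_add_iff_nonneg_right]; positivity) hj
  have hj2 : 4 * K / η ≤ j := le_trans (by simp only [le_add_iff_nonneg_left]; positivity) hj
  have hj0 : 0 < j := lt_of_lt_of_le (by positivity) hj1
  have ht0 : 0 < (t : ℝ) := lt_of_lt_of_le (by positivity) ht
  have hblock : (blockLength d L r : ℝ) = η * r ^ 2 := by
    unfold blockLength
    rw [Real.coe_toNNReal _ (by positivity), hη]
    ring
  have hblock0 : 0 < blockLength d L r := by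
    rw [← NNReal.coe_pos, hblock]; positivity
  set M : ℕ := ⌊t / blockLength d L r⌋₊ + 1 with hM
  -- The factor 4 leaves strict room above M + d m ≤ 3 d m.
  set m : ℝ := j * t / (4 * K * d * r ^ 2) with hm
  have hjt : j * t = 4 * K * d * r ^ 2 * m := by rw [hm]; field_simp
  have hm1 : 1 ≤ m := by
    rw [hm, one_le_div (by positivity)]
    calc 4 * K * d * r ^ 2 = 4 * K * d / δ * (δ * r ^ 2) := by field_simp
      _ ≤ j * t := by gcongr
  have htM : t < M * blockLength d L r := by
    rw [← div_lt_iff₀ hblock0, hM]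
    exact_mod_cast Nat.lt_floor_add_one (t / blockLength d L r)
  have hMm : (M : ℝ) ≤ 2 * d * m := by
    have h1 : (M : ℝ) ≤ t / (η * r ^ 2) + 1 := by
      rw [← hblock, hM]
      have := Nat.floor_le (zero_le (a := t / blockLength d L r))
      push_cast
      gcongr
      exact_mod_cast this
    have h2 : t / (η * r ^ 2) ≤ d * m := by
      calc t / (η * r ^ 2) = 4 * K / η * t / (4 * K * r ^ 2) := by field_simp
        _ ≤ j * t / (4 * K * r ^ 2) := by gcongr
        _ = d * m := by rw [hm]; field_simp
    nlinarith
  refine (measure_le_newtonianCapacity_wienerSausage (by lia) hB hL hr htM hm1 hMm ?_).trans ?_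
  · have h1 : (4 * r) ^ (d - 2) / greenConst d = K * r ^ 2 * r ^ (d - 4) := by
      rw [hKdef, mul_pow, show d - 2 = 2 + (d - 4) by lia, pow_add r]
      ring
    rw [h1, hjt]
    have h2 : M + d * m ≤ 3 * d * m := by linarith
    calc (M + d * m) * (K * r ^ 2 * r ^ (d - 4))
        ≤ 3 * d * m * (K * r ^ 2 * r ^ (d - 4)) := by gcongr
      _ < 4 * d * m * (K * r ^ 2 * r ^ (d - 4)) := by gcongr; norm_num
      _ = _ := by ring
  · refine ENNReal.ofReal_le_ofReal (Real.exp_le_exp.2 (neg_le_neg ?_))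
    have h1 : L / 4 - 3 * d = 4 * K * d * R ^ 2 + 9 := by rw [hLdef]; ring
    rw [one_mul, hjt, h1]
    have h2 : 4 * K * d * r ^ 2 ≤ 4 * K * d * R ^ 2 := by gcongr
    exact mul_le_mul_of_nonneg_right (by linarith) (by linarith)
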